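/- **Setting.** There are $M$ sources, $\mathcal M=\{1,\dots,M\}$. Source $m$ is a Markov chain on $\mathcal X^m=\{1,\dots,N_m\}$ with an irreducible stochastic matrix $\mathbf Q^m$ with positive diagonal, $\mathbf Q^m_{i,i}>0$ for all $i$. Let $p_s\in(0,1]$ be the success probability of a transmission and $d\in\{0,1\}$ the channel delay. A system state is $s=(s(m))_{m\in\mathcal M}$ with $s(m)=(i,j)\in\mathcal X^m\times\mathcal X^m$ (source state, reconstructed state); $\mathcal S$ is the set of system states. The actions are $\mathcal A=\{0,1,\dots,M\}$, where $0$ means idle and $m\ne 0$ means that source $m$ transmits. The transition probabilities are $P(s'\mid s,a)=\prod_{m\in\mathcal M} P^m(s'(m)\mid s(m),a)$, where, for $s(m)=(i,j)$: - if $a=m$ and $i\neq j$, then $P^m$ gives $(k,i)$ probability $\mathbf Q^m_{i,k}\,p_s$ and $(k,j)$ probability $\mathbf Q^m_{i,k}(1-p_s)$, for each $k\in\mathcal X^m$; - if $a\ne m$ or $i=j$, then $P^m$ gives $(k,j)$ probability $\mathbf Q^m_{i,k}$, for each $k\in\mathcal X^m$; - all other probabilities are $0$. Let $\omega_m\in\mathbb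 R$ be weights and $\delta^m:\mathcal X^m\times\mathcal X^m\to\mathbb R_{\ge0}$ control costs. Write $s(m)=(i_m,j_m)$ and $s'(m)=(i'_m,j'_m)$. The cost of actuation error is $c(s,a,s')=\sum_m\omega_m\delta^m(i_m,j'_m)$ if $d=0$, and $c(s,a,s')=\sum_m\omega_m\delta^m(i'_m,j'_m)$ if $d=1$. For $\lambda\ge 0$ put $l^\lambda(s,a,s')=c(s,a,s')+\lambda\,\mathbf 1(a\neq 0)$. For a policy $\pi$, that is, any possibly randomized, history-dependent and non-stationary policy, the set of which is $\Pi$, let $$\mathcal L^\lambda_s(\pi)=\limsup_{T\to\infty}\frac1T\sum_{t=1}^T\mathbb E^\pi\bigl[l^\lambda(S_t,A_t,S_{t+1})\mid S_1=s\bigr].$$ Fix a reference state $s_{\rm ref}\in\mathcal S$. Relative value iteration starts from $\mathbf v^0=\tilde{\mathbf v}^0=\mathbf 0$ and puts, for $k\ge 0$ and $s\in\mathcal S$, $$\mathbf v^{k+1}(s)=\min_{a\in\mathcal A}\sum_{s'\in\mathcal S}P(s'\mid s,a)\bigl(l^\lambda(s,a,s')+\tilde{\mathbf v}^k(s')\bigr),\qquad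 \tilde{\mathbf v}^{k+1}(s)=\mathbf v^{k+1}(s)-\mathbf v^{k+1}(s_{\rm ref}).$$ **Proposition.** For every $\lambda\ge 0$ and every $s_{\rm ref}\in\mathcal S$, the sequence $(\mathbf v^k)_{k\ge0}$ converges to some $\mathbf v^*\in\mathbb R^{\mathcal S}$. Moreover, the optimal Lagrangian average cost $\mathcal L^\lambda:=\inf_{\pi\in\Pi}\mathcal L_s^\lambda(\pi)$ is the same for all initial states $s\in\mathcal S$ and equals $\mathbf v^*(s_{\rm ref})$, and $\mathbf h^\lambda:=\mathbf v^*-\mathbf v^*(s_{\rm ref})$ solves Bellman's optimality equation $$\mathcal L^\lambda+\mathbf h^\lambda(s)=\min_{a\in\mathcal A}\sum_{s'\in\mathcal S}P(s'\mid s,a)\bigl(l^\lambda(s,a,s')+\mathbf h^\lambda(s')\bigr)\qquad\text{for all } s\in\mathcal S.$$ -/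

import Mathlib

namespace SemanticRE

/-! ### Finite Markov decision processes with the average-cost criterion -/

section MDP

/-- The information available when the action of slot `t` is chosen (slots are numbered from `0`):
the states of the slots `0, …, t` and the actions of the slots `0, …, t - 1`. -/
def Hist (S A : Type) : ℕ → Type
  | 0 => S
  | t + 1 => Hist S A t × A × S

/-- The current (latest) state of a history. -/
def Hist.last {S A : Type} : (t : ℕ) → Hist S A t → S
  | 0, s => s
  | _ + 1, h => h.2.2

instance Hist.instFintype (S A : Type) [Fintype S] [Fintype A] : (t : ℕ) → Fintype (Hist S A t)
  | 0 => inferInstanceAs (Fintype S)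
  | t + 1 =>
    letI := Hist.instFintype S A t
    inferInstanceAs (Fintype (Hist S A t × A × S))

/-- A (randomized, history-dependent, non-stationary) policy: in slot `t`, after the history `h`,
the action `a` is chosen with probability `prob t h a`. -/
structure Policy (S A : Type) [Fintype A] where
  prob : (t : ℕ) → Hist S A t → A → ℝ
  prob_nonneg : ∀ t h a, 0 ≤ prob t h a
  prob_sum : ∀ t h, ∑ a, prob t h a = 1

variable {S A : Type} [Fintype S] [DecidableEq S] [Fintype A]

/-- The probability that the history up to slot `t` equals the given one, when policy `π` is used
with the initial state `s` and the transition probabilities `P s a s'` (from `s` to `s'` under the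
action `a`). -/
def histProb (P : S → A → S → ℝ) (π : Policy S A) (s : S) : (t : ℕ) → Hist S A t → ℝ
  | 0, s₀ => if Hist.last 0 s₀ = s then 1 else 0
  | t + 1, (h, a, s') => histProb P π s t h * π.prob t h a * P (Hist.last t h) a s'

/-- The expectation `𝔼^π [l (S_t, A_t, S_{t+1}) | S_0 = s]`. -/
noncomputable def expectedCost (P l : S → A → S → ℝ) (π : Policy S A) (s : S) (t : ℕ) : ℝ :=
  ∑ h : Hist S A (t + 1), histProb P π s (t + 1) h * l (Hist.last t h.1) h.2.1 h.2.2

/-- The limsup average cost of the policy `π` from the initial state `s`. -/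
noncomputable def averageCost (P l : S → A → S → ℝ) (π : Policy S A) (s : S) : ℝ :=
  Filter.limsup (fun T : ℕ => (1 / (T : ℝ)) * ∑ t ∈ Finset.range T, expectedCost P l π s t) Filter.atTop

/-- `g` is the optimal average cost from every initial state: for each `s` it is the infimum of the
limsup average cost over all policies. -/
def IsOptimalAverageCost (P l : S → A → S → ℝ) (g : ℝ) : Prop :=
  ∀ s : S, IsGLB (Set.range fun π : Policy S A => averageCost P l π s) g

/-- The Bellman operator
`(T v) (s) = min_a ∑_{s'} P (s' | s, a) (l (s, a, s') + v (s'))`. -/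
noncomputable def bellman [Nonempty A] (P l : S → A → S → ℝ) (v : S → ℝ) : S → ℝ := fun s =>
  Finset.univ.inf' Finset.univ_nonempty fun a : A => ∑ s', P s a s' * (l s a s' + v s')

/-- `(g, h)` solves Bellman's optimality equation of the average-cost problem. -/
def SolvesBellman [Nonempty A] (P l : S → A → S → ℝ) (g : ℝ) (h : S → ℝ) : Prop :=
  ∀ s : S, g + h s = bellman P l h s

/-- The value functions `v ^ k` of relative value iteration with the reference state `sref`:
`v ^ 0 = 0` and `v ^ (k + 1) = T (v ^ k - v ^ k (sref))`. -/
noncomputable def rvi [Nonempty A] (P l : S → A → S → ℝ) (sref : S) : ℕ → S → ℝ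
  | 0 => 0
  | k + 1 => bellman P l fun s => rvi P l sref k s - rvi P l sref k sref

end MDP

/-! ### Remote estimation of several Markov sources -/

/-- The transmission delay: zero or one slot. -/
inductive Delay
  | zero
  | one

/-- The data of the remote estimation system with `M` sources. -/
structure Model (M : ℕ) where
  /-- The number of states of each source. -/
  N : Fin M → ℕ
  /-- The transition matrix of each source. -/
  Q : (m : Fin M) → Matrix (Fin (N m)) (Fin (N m)) ℝ
  Q_nonneg : ∀ m i j, 0 ≤ Q m i j
  Q_sum : ∀ m i, ∑ j, Q m i j = 1
  /-- The success probability of a transmission. -/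
  ps : ℝ
  ps_nonneg : 0 ≤ ps
  ps_le_one : ps ≤ 1
  /-- The channel delay. -/
  d : Delay
  /-- The weight of each source. -/
  ω : Fin M → ℝ
  /-- The control cost `δ m i j` of source state `i` and reconstructed state `j`. -/
  δ : (m : Fin M) → Fin (N m) → Fin (N m) → ℝ
  δ_nonneg : ∀ m i j, 0 ≤ δ m i j

namespace Model

variable {M : ℕ} (E : Model M)

/-- System states: a pair (source state, reconstructed state) for each source. For zero delay the
state in slot `t` is `(X_t, X̂_{t-1})`, for one delay it is `(X_t, X̂_t)`. -/
abbrev State : Type := (m : Fin M) → Fin (E.N m) × Fin (E.N m)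

/-- Actions: `none` is the idle action `0`, and `some m` samples and transmits source `m`. -/
abbrev Action (_E : Model M) : Type := Option (Fin M)

/-- The transition probability of subsystem `m` from `x = (i, j)` to `y = (k, j')` under action `a`:
the source moves from `i` to `k`; the estimate becomes `i` after a successful transmission of
source `m` and stays `j` otherwise. -/
noncomputable def subTrans (m : Fin M) (a : Option (Fin M))
    (x y : Fin (E.N m) × Fin (E.N m)) : ℝ :=
  if a = some m ∧ x.1 ≠ x.2 then
    if y.2 = x.1 then E.Q m x.1 y.1 * E.ps
    else if y.2 = x.2 then E.Q m x.1 y.1 * (1 - E.ps)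
    else 0
  else if y.2 = x.2 then E.Q m x.1 y.1
  else 0

/-- The system transition probability `P (s' | s, a)`. -/
noncomputable def trans (s : E.State) (a : E.Action) (s' : E.State) : ℝ :=
  ∏ m, E.subTrans m a (s m) (s' m)

/-- The cost of actuation error `c (S_t, A_t, S_{t+1}) = ∑ m, ω_m δ^m (X_{t+d}, X̂_{t+d})`. For zero
delay `X_t` is read off `S_t` and `X̂_t` off `S_{t+1}`; for one delay both `X_{t+1}` and `X̂_{t+1}`
are read off `S_{t+1}`. -/
noncomputable def actuationCost (s : E.State) (_a : E.Action) (s' : E.State) : ℝ :=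
  match E.d with
  | Delay.zero => ∑ m, E.ω m * E.δ m (s m).1 (s' m).2
  | Delay.one => ∑ m, E.ω m * E.δ m (s' m).1 (s' m).2

/-- The transmission cost `1(a ≠ 0)`. -/
noncomputable def transmissionCost (_s : E.State) (a : E.Action) : ℝ :=
  if a = none then 0 else 1

/-- The Lagrangian cost `l^λ (s, a, s') = c (s, a, s') + λ f (s, a)`. -/
noncomputable def lagrangianCost (lam : ℝ) (s : E.State) (a : E.Action) (s' : E.State) : ℝ :=
  E.actuationCost s a s' + lam * E.transmissionCost s a

end Model

end SemanticRE

namespace SemanticRE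

open Filter Topology

/-! ### Two facts on real sequences -/

/-! Let `T` be the Bellman operator. Any system state can reach any other, so the iterates `T^k 0`
have bounded span; as `T` is nonexpansive and commutes with constants, `T^k 0 - k g` is then bounded
for some `g`. The delicate point is to exclude periodic behaviour: if `ps = 1`, a mismatched source
that transmits cannot keep its pair, so self-loops may be missing. Yet every action allows either a
self-loop or a strict drop in the number of mismatched sources, and such a rank can drop only
finitely often. Hence a persistent positive increment would make the bounded sequence grow linearly
along a backward path (`eventually_increment_le`), and the increments tend to 0. A cluster point `h`
then solves Bellman's equation, and nonexpansiveness upgrades subsequential convergence to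
convergence (`exists_tendsto_iterate_bellman`). Relative value iteration differs from `T^k 0` by
constants (`tendsto_rvi`), and telescoping Bellman's equation identifies `g` as the optimal cost
(`SolvesBellman.isOptimalAverageCost`). -/

theorem exists_abs_sub_mul_le_of_quasiadditive {f : ℕ → ℝ} {D : ℝ}
    (h : ∀ m n, |f (m + n) - f m - f n| ≤ D) : ∃ g : ℝ, ∀ n : ℕ, |f n - n * g| ≤ D := by
  have hD : 0 ≤ D := (abs_nonneg _).trans (h 0 0)
  -- Fekete's lemma applies to both `f + D` and `D - f`. Their quotients by `n` add up to `2 * D /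
  -- n`, so the limits are opposite; each limit is an infimum, which gives the two bounds.
  have hadd : Subadditive fun n => f n + D := fun m n => by
    have := (abs_le.1 (h m n)).2
    linarith
  have hsub : Subadditive fun n => D - f n := fun m n => by
    have := (abs_le.1 (h m n)).1
    linarith
  have hgrow : ∀ n : ℕ, |f n| ≤ D + n * (|f 1| + D) := fun n => by
    induction n with
    | zero =>
      have := h 0 0
      simpa using this
    | succ n ih =>
      have h1 := abs_le.1 (h n 1)
      have h2 := abs_le.1 ih
      have h3 := abs_le.1 (le_refl |f 1|)
      push_cast
      rw [abs_le]
      constructor <;> linarith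
  have hbdd : ∀ e : ℕ → ℝ, (∀ n, |e n| ≤ 2 * D + n * (|f 1| + D)) →
      BddBelow (Set.range fun n : ℕ => e n / n) := fun e he => by
    refine ⟨-(2 * D + (|f 1| + D)), ?_⟩
    rintro _ ⟨n, rfl⟩
    rcases Nat.eq_zero_or_pos n with rfl | hn
    · simp only [Nat.cast_zero, div_zero]
      have := abs_nonneg (f 1)
      linarith
    · have hn' : (1 : ℝ) ≤ n := by exact_mod_cast hn
      simp only
      rw [le_div_iff₀ (by linarith)]
      have := (abs_le.1 (he n)).1
      nlinarith
  have hb1 := hbdd (fun n => f n + D) fun n => by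
    have := abs_le.1 (hgrow n)
    rw [abs_le]
    constructor <;> linarith
  have hb2 := hbdd (fun n => D - f n) fun n => by
    have := abs_le.1 (hgrow n)
    rw [abs_le]
    constructor <;> linarith
  have hlim : hsub.lim = -hadd.lim := by
    refine tendsto_nhds_unique (hsub.tendsto_lim hb2) ?_
    have h0 : Tendsto (fun n : ℕ => 2 * D / (n : ℝ)) atTop (𝓝 0) :=
      tendsto_const_div_atTop_nhds_zero_nat _
    have := h0.sub (hadd.tendsto_lim hb1)
    rw [zero_sub] at this
    refine this.congr fun n => ?_
    rw [← sub_div]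
    congr 1
    ring
  refine ⟨hadd.lim, fun n => ?_⟩
  rcases Nat.eq_zero_or_pos n with rfl | hn
  · have := h 0 0
    simpa using this
  · have hn' : (0 : ℝ) < n := by exact_mod_cast hn
    have h1 := hadd.lim_le_div hb1 hn.ne'
    have h2 := hsub.lim_le_div hb2 hn.ne'
    rw [hlim] at h2
    rw [le_div_iff₀ hn'] at h1 h2
    rw [abs_le]
    constructor <;> linarith

/-- If a large increment of `x` at `s` forces a large earlier increment at `s` itself or at a point
of smaller rank `φ`, then a bounded `x` has increments that are eventually at most `ε`. -/
theorem eventually_increment_le {S : Type*} [Fintype S] [Nonempty S] {x : ℕ → S → ℝ} {B p : ℝ}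
    {φ : S → ℕ} (hB : ∀ k s, |x k s| ≤ B) (hp : 0 < p) (hp1 : p ≤ 1)
    (hstep : ∀ k s, ∃ s', (s' = s ∨ φ s' < φ s) ∧ ∀ D, (∀ t, x (k + 1) t - x k t ≤ D) →
      x (k + 2) s - x (k + 1) s ≤ p * (x (k + 1) s' - x k s') + (1 - p) * D)
    {ε : ℝ} (hε : 0 < ε) : ∃ K, ∀ k ≥ K, ∀ s, x (k + 1) s - x k s ≤ ε := by
  have hB0 : 0 ≤ B := (abs_nonneg _).trans (hB 0 (Classical.arbitrary S))
  set d : ℕ → ℝ := fun k => Finset.univ.sup' Finset.univ_nonempty fun s => x (k + 1) s - x k s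
    with hd
  have hle : ∀ k s, x (k + 1) s - x k s ≤ d k := fun k s =>
    Finset.le_sup' (fun s => x (k + 1) s - x k s) (Finset.mem_univ s)
  have hanti : Antitone d := antitone_nat_of_succ_le fun k => by
    refine Finset.sup'_le _ _ fun s _ => ?_
    obtain ⟨s', -, h⟩ := hstep k s
    have h1 := h _ (hle k)
    have h2 := hle k s'
    nlinarith
  have hbelow : BddBelow (Set.range d) := by
    refine ⟨-(2 * B), ?_⟩
    rintro _ ⟨k, rfl⟩
    have s := Classical.arbitrary S
    have h0 := hle k s
    have h1 := abs_le.1 (hB k s)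
    have h2 := abs_le.1 (hB (k + 1) s)
    linarith
  set D := ⨅ k, d k with hDdef
  have hlim : Tendsto d atTop (𝓝 D) := tendsto_atTop_ciInf hanti hbelow
  have hDle : ∀ k, D ≤ d k := fun k => ciInf_le hbelow k
  have hD : D ≤ 0 := by
    by_contra! hD
    -- Going one slot back multiplies the gap to `U` by at most `1 / p`, so a gap of `p ^ L * (D /
    -- 2)` leaves increments of at least `D / 2` for `L` slots back. Each adds `D / 2` to `x`; each
    -- change of state costs at most `2 * B` and lowers the rank.
    have key : ∀ (L K : ℕ) (U : ℝ), D ≤ U → (∀ k ≥ K, d k ≤ U) → ∀ k ≥ K + L, ∀ s,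
        U - (x (k + 1) s - x k s) ≤ p ^ L * (D / 2) →
        L * (D / 2) ≤ x (k + 1) s + B + 2 * B * φ s := by
      intro L K U hDU hU
      induction L with
      | zero =>
        intro k _ s _
        have h1 := abs_le.1 (hB (k + 1) s)
        have : 0 ≤ 2 * B * (φ s : ℝ) := by positivity
        simp only [Nat.cast_zero, zero_mul]
        linarith
      | succ L ih =>
        intro k hk s hs
        obtain ⟨k, rfl⟩ : ∃ j, k = j + 1 := ⟨k - 1, by omega⟩
        obtain ⟨s', hs', h⟩ := hstep k s
        have h1 := h U fun t => (hle k t).trans (hU k (by omega))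
        have h2 : U - (x (k + 1) s' - x k s') ≤ p ^ L * (D / 2) := by
          have : p * (U - (x (k + 1) s' - x k s')) ≤ p * (p ^ L * (D / 2)) := by
            rw [pow_succ] at hs
            linarith
          exact le_of_mul_le_mul_left this hp
        have h3 := ih k (by omega) s' h2
        have h4 : x (k + 1) s' + 2 * B * φ s' ≤ x (k + 1) s + 2 * B * φ s := by
          rcases hs' with rfl | hlt
          · exact le_rfl
          · have h5 := abs_le.1 (hB (k + 1) s)
            have h6 := abs_le.1 (hB (k + 1) s')
            have h7 : (φ s' : ℝ) + 1 ≤ φ s := by exact_mod_cast hlt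
            nlinarith
        have h8 : p ^ (L + 1) * (D / 2) ≤ D / 2 :=
          mul_le_of_le_one_left (by linarith) (pow_le_one₀ hp.le hp1)
        push_cast
        linarith
    obtain ⟨R, hR⟩ := (Set.finite_range φ).bddAbove
    -- `L` is fixed before `K`: first the forced growth exceeds the bound on `x`, then `d` is
    -- brought close enough to its limit for `L` backward slots.
    obtain ⟨L, hL⟩ := exists_nat_gt ((2 * B + 2 * B * R) / (D / 2))
    rw [div_lt_iff₀ (by linarith)] at hL
    have hpos : 0 < p ^ L * (D / 2) := by positivity
    obtain ⟨K, hK⟩ := eventually_atTop.1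
      (hlim.eventually (gt_mem_nhds (show D < D + p ^ L * (D / 2) by linarith)))
    obtain ⟨s, -, hs⟩ := Finset.exists_mem_eq_sup' Finset.univ_nonempty
      fun s => x (K + L + 1) s - x (K + L) s
    have h1 := hDle (K + L)
    have h2 := key L K (D + p ^ L * (D / 2)) (by linarith) (fun k hk => (hK k hk).le) (K + L) le_rfl
      s (by rw [← hs]; linarith)
    have h3 := abs_le.1 (hB (K + L + 1) s)
    have h4 : (φ s : ℝ) ≤ R := by exact_mod_cast hR ⟨s, rfl⟩
    nlinarith
  obtain ⟨K, hK⟩ := eventually_atTop.1 (hlim.eventually (gt_mem_nhds (hD.trans_lt hε)))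
  exact ⟨K, fun k hk s => (hle k s).trans (hK k hk).le⟩

/-! ### The Bellman operator -/

theorem exists_forall_abs_le {S A : Type} [Finite S] [Finite A] (l : S → A → S → ℝ) :
    ∃ C, ∀ s a s', |l s a s'| ≤ C := by
  obtain ⟨C, hC⟩ := (Set.finite_range fun x : S × A × S => |l x.1 x.2.1 x.2.2|).bddAbove
  exact ⟨C, fun s a s' => hC ⟨(s, a, s'), rfl⟩⟩

section Bellman

variable {S A : Type} [Fintype S] [Fintype A] [Nonempty A] {P l : S → A → S → ℝ}

theorem bellman_le (P l : S → A → S → ℝ) (v : S → ℝ) (s : S) (a : A) :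
    bellman P l v s ≤ ∑ s', P s a s' * (l s a s' + v s') :=
  Finset.inf'_le _ (Finset.mem_univ a)

theorem exists_eq_bellman (P l : S → A → S → ℝ) (v : S → ℝ) (s : S) :
    ∃ a, bellman P l v s = ∑ s', P s a s' * (l s a s' + v s') := by
  obtain ⟨a, -, ha⟩ := Finset.exists_mem_eq_inf' Finset.univ_nonempty
    fun a : A => ∑ s', P s a s' * (l s a s' + v s')
  exact ⟨a, ha⟩

/-- An action that attains the minimum for `v`. -/
theorem exists_bellman_sub_le (P l : S → A → S → ℝ) (v : S → ℝ) (s : S) :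
    ∃ a, ∀ w, bellman P l w s - bellman P l v s ≤ ∑ s', P s a s' * (w s' - v s') := by
  obtain ⟨a, ha⟩ := exists_eq_bellman P l v s
  refine ⟨a, fun w => ?_⟩
  have := bellman_le P l w s a
  rw [ha, sub_le_iff_le_add, ← Finset.sum_add_distrib]
  refine this.trans (le_of_eq (Finset.sum_congr rfl fun s' _ => ?_))
  ring

theorem sum_mul_le_of_le {q w : S → ℝ} {c : ℝ} (hq : ∀ s, 0 ≤ q s) (hq1 : ∑ s, q s = 1)
    (hw : ∀ s, w s ≤ c) : ∑ s, q s * w s ≤ c := by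
  calc ∑ s, q s * w s ≤ ∑ s, q s * c :=
        Finset.sum_le_sum fun s _ => mul_le_mul_of_nonneg_left (hw s) (hq s)
    _ = c := by rw [← Finset.sum_mul, hq1, one_mul]

/-- The deficits `c - w s` are nonnegative, so their mean is at least the single term at `t`. -/
theorem sum_mul_le_add {q w : S → ℝ} {c p : ℝ} (hq : ∀ s, 0 ≤ q s) (hq1 : ∑ s, q s = 1)
    (hw : ∀ s, w s ≤ c) {t : S} (ht : p ≤ q t) :
    ∑ s, q s * w s ≤ p * w t + (1 - p) * c := by
  have h1 : p * (c - w t) ≤ ∑ s, q s * (c - w s) :=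
    (mul_le_mul_of_nonneg_right ht (sub_nonneg.2 (hw t))).trans
      (Finset.single_le_sum (f := fun s => q s * (c - w s))
        (fun s _ => mul_nonneg (hq s) (sub_nonneg.2 (hw s))) (Finset.mem_univ t))
  have h2 : ∑ s, q s * (c - w s) = c - ∑ s, q s * w s := by
    simp only [mul_sub, Finset.sum_sub_distrib]
    rw [← Finset.sum_mul, hq1, one_mul]
  linarith

theorem bellman_add_const (hP1 : ∀ s a, ∑ s', P s a s' = 1) (v : S → ℝ) (c : ℝ) :
    bellman P l (fun s => v s + c) = fun s => bellman P l v s + c := by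
  have key : ∀ s a, ∑ s', P s a s' * (l s a s' + (v s' + c)) =
      (∑ s', P s a s' * (l s a s' + v s')) + c := fun s a => by
    conv_rhs => rw [← one_mul c, ← hP1 s a, Finset.sum_mul, ← Finset.sum_add_distrib]
    exact Finset.sum_congr rfl fun s' _ => by ring
  funext s
  refine le_antisymm ?_ ?_
  · obtain ⟨a, ha⟩ := exists_eq_bellman P l v s
    rw [ha, ← key]
    exact bellman_le P l _ s a
  · obtain ⟨a, ha⟩ := exists_eq_bellman P l (fun s => v s + c) s
    rw [ha, key]
    exact add_le_add_left (bellman_le P l _ s a) c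

theorem bellman_le_add (hP0 : ∀ s a s', 0 ≤ P s a s') (hP1 : ∀ s a, ∑ s', P s a s' = 1)
    {v w : S → ℝ} {c : ℝ} (h : ∀ s, w s ≤ v s + c) (s : S) :
    bellman P l w s ≤ bellman P l v s + c := by
  obtain ⟨a, ha⟩ := exists_bellman_sub_le P l v s
  have h1 := ha w
  have h2 := sum_mul_le_of_le (w := fun s => w s - v s) (hP0 s a) (hP1 s a)
    fun s => sub_le_iff_le_add'.2 (h s)
  linarith

theorem abs_bellman_sub_le (hP0 : ∀ s a s', 0 ≤ P s a s') (hP1 : ∀ s a, ∑ s', P s a s' = 1)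
    {v w : S → ℝ} {c : ℝ} (h : ∀ s, |w s - v s| ≤ c) (s : S) :
    |bellman P l w s - bellman P l v s| ≤ c := by
  have h1 := bellman_le_add (l := l) hP0 hP1 (v := v) (w := w)
    (fun s => by have := (abs_le.1 (h s)).2; linarith) s
  have h2 := bellman_le_add (l := l) hP0 hP1 (v := w) (w := v)
    (fun s => by have := (abs_le.1 (h s)).1; linarith) s
  rw [abs_le]
  constructor <;> linarith

theorem abs_iterate_bellman_sub_le (hP0 : ∀ s a s', 0 ≤ P s a s')
    (hP1 : ∀ s a, ∑ s', P s a s' = 1) {v w : S → ℝ} {c : ℝ} (h : ∀ s, |w s - v s| ≤ c) (n : ℕ)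
    (s : S) : |(bellman P l)^[n] w s - (bellman P l)^[n] v s| ≤ c := by
  induction n generalizing s with
  | zero => exact h s
  | succ n ih =>
    simp only [Function.iterate_succ_apply']
    exact abs_bellman_sub_le hP0 hP1 ih s

theorem iterate_bellman_add_const (hP1 : ∀ s a, ∑ s', P s a s' = 1) (v : S → ℝ) (c : ℝ) (n : ℕ) :
    (bellman P l)^[n] (fun s => v s + c) = fun s => (bellman P l)^[n] v s + c := by
  induction n with
  | zero => rfl
  | succ n ih => simp only [Function.iterate_succ_apply', ih, bellman_add_const hP1]

theorem continuous_bellman (P l : S → A → S → ℝ) : Continuous (bellman P l) := by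
  refine continuous_pi fun s => ?_
  unfold bellman
  refine Continuous.finset_inf'_apply _ fun a _ => ?_
  fun_prop

end Bellman

/-! ### Communicating decision processes -/

section Communicating

variable {S A : Type} [Fintype S] [Fintype A] [Nonempty A] {P l : S → A → S → ℝ}

/-- Follow a path of length `n` from `s` to `t`, which succeeds with probability `ε`; off the path
only the crude bound `U` is used, and `K` absorbs the costs. -/
theorem exists_iterate_bellman_le (hP0 : ∀ s a s', 0 ≤ P s a s')
    (hP1 : ∀ s a, ∑ s', P s a s' = 1) {C : ℝ} (hl : ∀ s a s', l s a s' ≤ C) {s t : S}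
    (hst : Relation.ReflTransGen (fun s t => ∃ a, 0 < P s a t) s t) :
    ∃ (n : ℕ) (ε K : ℝ), 0 < ε ∧ ∀ (w : S → ℝ) (U : ℝ), (∀ r, w r ≤ U) →
      (bellman P l)^[n] w s ≤ K + ε * w t + (1 - ε) * U := by
  have hone : ∀ s a (w : S → ℝ), bellman P l w s ≤ C + ∑ s', P s a s' * w s' := fun s a w => by
    refine (bellman_le P l w s a).trans ?_
    simp only [mul_add, Finset.sum_add_distrib]
    exact add_le_add_left (sum_mul_le_of_le (hP0 s a) (hP1 s a) (hl s a)) _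
  have hiter : ∀ (n : ℕ) (w : S → ℝ) (U : ℝ), (∀ r, w r ≤ U) →
      ∀ r, (bellman P l)^[n] w r ≤ U + n * C := fun n w U hU => by
    induction n with
    | zero => simpa using hU
    | succ n ih =>
      intro r
      rw [Function.iterate_succ_apply']
      obtain ⟨a⟩ := ‹Nonempty A›
      have := sum_mul_le_of_le (hP0 r a) (hP1 r a) ih
      have := hone r a ((bellman P l)^[n] w)
      push_cast
      linarith
  induction hst using Relation.ReflTransGen.head_induction_on with
  | refl => exact ⟨0, 1, 0, one_pos, fun w U _ => by simp⟩
  | head hsr _ ih =>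
    rename_i s r _
    obtain ⟨a, ha⟩ := hsr
    obtain ⟨n, ε, K, hε, h⟩ := ih
    -- Condition on the first step: it hits `r` with probability `P s a r`, and otherwise the
    -- iterate is at most `U + n * C`.
    refine ⟨n + 1, P s a r * ε, C + P s a r * K + (1 - P s a r) * (n * C), by positivity,
      fun w U hU => ?_⟩
    rw [Function.iterate_succ_apply']
    have h1 := hone s a ((bellman P l)^[n] w)
    have h2 := sum_mul_le_add (hP0 s a) (hP1 s a) (hiter n w U hU) (le_refl (P s a r))
    have h3 := mul_le_mul_of_nonneg_left (h w U hU) ha.le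
    linarith

theorem abs_bellman_zero_le (hP0 : ∀ s a s', 0 ≤ P s a s') (hP1 : ∀ s a, ∑ s', P s a s' = 1)
    {C : ℝ} (hl : ∀ s a s', |l s a s'| ≤ C) (s : S) : |bellman P l 0 s| ≤ C := by
  obtain ⟨a, ha⟩ := exists_eq_bellman P l 0 s
  rw [ha]
  simp only [Pi.zero_apply, add_zero]
  refine (Finset.abs_sum_le_sum_abs _ _).trans ?_
  simp only [abs_mul, abs_of_nonneg (hP0 s a _)]
  exact sum_mul_le_of_le (hP0 s a) (hP1 s a) (hl s a)

/-- At a maximizer `s` of `w = T^k 0`, the path bound with `U = w s` caps `T^n w s`, while bounded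
increments give `T^n w s ≥ w s - n * C`. Together `ε * (w s - w t) ≤ K + n * C`. -/
theorem exists_abs_iterate_bellman_sub_le (hP0 : ∀ s a s', 0 ≤ P s a s')
    (hP1 : ∀ s a, ∑ s', P s a s' = 1)
    (hcomm : ∀ s t, Relation.ReflTransGen (fun s t => ∃ a, 0 < P s a t) s t) :
    ∃ D, ∀ k s t, |(bellman P l)^[k] 0 s - (bellman P l)^[k] 0 t| ≤ D := by
  obtain ⟨C, hC⟩ := exists_forall_abs_le l
  choose n ε K hε h using fun s t => exists_iterate_bellman_le (l := l) hP0 hP1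
    (fun s a s' => (le_abs_self _).trans (hC s a s')) (hcomm s t)
  have hinc : ∀ k s, |(bellman P l)^[k + 1] 0 s - (bellman P l)^[k] 0 s| ≤ C := fun k s => by
    rw [Function.iterate_succ_apply]
    refine abs_iterate_bellman_sub_le hP0 hP1 (fun s => ?_) k s
    simpa using abs_bellman_zero_le hP0 hP1 hC s
  have hlow : ∀ n k s, (bellman P l)^[k] 0 s - n * C ≤ (bellman P l)^[k + n] 0 s := fun n k s => by
    induction n with
    | zero => simp
    | succ n ih =>
      have := (abs_le.1 (hinc (k + n) s)).1
      push_cast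
      rw [← add_assoc]
      linarith
  obtain ⟨D, hD⟩ := (Set.finite_range fun x : S × S =>
    (K x.1 x.2 + n x.1 x.2 * C) / ε x.1 x.2).bddAbove
  have hmax : ∀ k s t, (∀ r, (bellman P l)^[k] 0 r ≤ (bellman P l)^[k] 0 s) →
      (bellman P l)^[k] 0 s - (bellman P l)^[k] 0 t ≤ D := fun k s t hs => by
    refine le_trans ?_ (hD ⟨(s, t), rfl⟩)
    simp only
    rw [le_div_iff₀ (hε s t)]
    have h1 := h s t _ _ hs
    have h2 := hlow (n s t) k s
    rw [add_comm k, Function.iterate_add_apply] at h2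
    linarith
  refine ⟨D, fun k s t => ?_⟩
  have : Nonempty S := ⟨s⟩
  obtain ⟨r, hr⟩ := Finite.exists_max ((bellman P l)^[k] 0)
  have h1 := hmax k r s hr
  have h2 := hmax k r t hr
  rw [abs_le]
  constructor <;> linarith [hr s, hr t]

theorem exists_abs_iterate_bellman_sub_mul_le [Nonempty S] (hP0 : ∀ s a s', 0 ≤ P s a s')
    (hP1 : ∀ s a, ∑ s', P s a s' = 1)
    (hcomm : ∀ s t, Relation.ReflTransGen (fun s t => ∃ a, 0 < P s a t) s t) :
    ∃ g B : ℝ, ∀ (k : ℕ) s, |(bellman P l)^[k] 0 s - k * g| ≤ B := by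
  obtain ⟨D, hD⟩ := exists_abs_iterate_bellman_sub_le (l := l) hP0 hP1 hcomm
  have s₀ := Classical.arbitrary S
  -- `T^n 0` is within `D` of the constant `T^n 0 s₀`, and applying `T^m` preserves this distance
  -- bound: the values at `s₀` are quasiadditive.
  obtain ⟨g, hg⟩ := exists_abs_sub_mul_le_of_quasiadditive
    (f := fun k => (bellman P l)^[k] 0 s₀) (D := D) fun m n => by
      rw [Function.iterate_add_apply]
      have := abs_iterate_bellman_sub_le (l := l) hP0 hP1
        (v := fun s => (0 : S → ℝ) s + (bellman P l)^[n] 0 s₀) (w := (bellman P l)^[n] 0) (c := D)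
        (fun s => by simpa using hD n s s₀) m s₀
      rw [iterate_bellman_add_const hP1] at this
      rwa [sub_sub]
  refine ⟨g, D + D, fun k s => ?_⟩
  have := (abs_add_le _ _).trans (add_le_add (hD k s s₀) (hg k))
  simpa using this

/-- Value iteration converges, after subtraction of its linear growth, when the process is
communicating and every state has under every action a possible successor that is the state itself
or has smaller rank. -/
theorem exists_tendsto_iterate_bellman [Nonempty S] (hP0 : ∀ s a s', 0 ≤ P s a s')
    (hP1 : ∀ s a, ∑ s', P s a s' = 1)
    (hcomm : ∀ s t, Relation.ReflTransGen (fun s t => ∃ a, 0 < P s a t) s t)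
    {φ : S → ℕ} (hφ : ∀ s a, ∃ s', (s' = s ∨ φ s' < φ s) ∧ 0 < P s a s') :
    ∃ (g : ℝ) (h : S → ℝ), SolvesBellman P l g h ∧
      Tendsto (fun (k : ℕ) s => (bellman P l)^[k] 0 s - k * g) atTop (𝓝 h) := by
  obtain ⟨g, B, hB⟩ := exists_abs_iterate_bellman_sub_mul_le (l := l) hP0 hP1 hcomm
  set x : ℕ → S → ℝ := fun k s => (bellman P l)^[k] 0 s - k * g with hx
  have hx1 : ∀ k s, x (k + 1) s = bellman P l (x k) s - g := fun k s => by
    have : x k = fun s => (bellman P l)^[k] 0 s + -(k * g) := by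
      funext s
      simp only [hx, sub_eq_add_neg]
    rw [this, bellman_add_const hP1]
    simp only [hx, Function.iterate_succ_apply']
    push_cast
    ring
  choose σ hσ hpos using hφ
  obtain ⟨p, hp, hp1, hpσ⟩ : ∃ p : ℝ, 0 < p ∧ p ≤ 1 ∧ ∀ s a, p ≤ P s a (σ s a) := by
    obtain ⟨y, hy⟩ := Finite.exists_min fun y : S × A => P y.1 y.2 (σ y.1 y.2)
    refine ⟨_, hpos y.1 y.2, ?_, fun s a => hy (s, a)⟩
    rw [← hP1 y.1 y.2]
    exact Finset.single_le_sum (fun s _ => hP0 _ _ s) (Finset.mem_univ _)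
  have hup : ∀ ε > 0, ∃ K, ∀ k ≥ K, ∀ s, x (k + 1) s - x k s ≤ ε := fun ε hε => by
    refine eventually_increment_le (x := x) (φ := φ) hB hp hp1 (fun k s => ?_) hε
    obtain ⟨a, ha⟩ := exists_bellman_sub_le P l (x k) s
    refine ⟨σ s a, hσ s a, fun D hD => ?_⟩
    have h1 := ha (x (k + 1))
    have h2 := sum_mul_le_add (w := fun t => x (k + 1) t - x k t) (hP0 s a) (hP1 s a) hD (hpσ s a)
    rw [hx1 (k + 1), hx1 k s]
    linarith
  -- For the opposite sign the action is taken optimal for the later iterate `x (k + 1)`, which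
  -- reverses the comparison.
  have hdown : ∀ ε > 0, ∃ K, ∀ k ≥ K, ∀ s, -x (k + 1) s - -x k s ≤ ε := fun ε hε => by
    refine eventually_increment_le (x := fun k s => -x k s) (φ := φ)
      (fun k s => (abs_neg _).trans_le (hB k s)) hp hp1 (fun k s => ?_) hε
    obtain ⟨a, ha⟩ := exists_bellman_sub_le P l (x (k + 1)) s
    refine ⟨σ s a, hσ s a, fun D hD => ?_⟩
    have h1 := ha (x k)
    have h2 := sum_mul_le_add (w := fun t => -x (k + 1) t - -x k t) (hP0 s a) (hP1 s a) hD
      (hpσ s a)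
    have h3 : ∑ s', P s a s' * (-x (k + 1) s' - -x k s') =
        ∑ s', P s a s' * (x k s' - x (k + 1) s') :=
      Finset.sum_congr rfl fun s' _ => by ring
    rw [hx1 (k + 1), hx1 k s]
    linarith
  have hinc : Tendsto (fun k => x (k + 1) - x k) atTop (𝓝 0) := by
    refine tendsto_pi_nhds.2 fun s => Metric.tendsto_atTop.2 fun ε hε => ?_
    obtain ⟨K₁, h₁⟩ := hup (ε / 2) (by linarith)
    obtain ⟨K₂, h₂⟩ := hdown (ε / 2) (by linarith)
    refine ⟨max K₁ K₂, fun k hk => ?_⟩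
    have h3 := h₁ k (le_of_max_le_left hk) s
    have h4 := h₂ k (le_of_max_le_right hk) s
    simp only [Pi.sub_apply, Pi.zero_apply, dist_zero_right, Real.norm_eq_abs]
    rw [abs_lt]
    constructor <;> linarith
  have hBnonneg : 0 ≤ B := (abs_nonneg _).trans (hB 0 (Classical.arbitrary S))
  obtain ⟨h, -, ψ, hψ, hlim⟩ := tendsto_subseq_of_bounded
    (Metric.isBounded_closedBall (x := 0) (r := B))
    (x := x) fun k => by
      rw [mem_closedBall_zero_iff, pi_norm_le_iff_of_nonneg hBnonneg]
      exact hB k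
  have hfix : ∀ s, g + h s = bellman P l h s := fun s => by
    have h1 : Tendsto (fun k => bellman P l (x (ψ k)) s) atTop (𝓝 (bellman P l h s)) :=
      tendsto_pi_nhds.1 (((continuous_bellman P l).tendsto h).comp hlim) s
    have h2 := (tendsto_pi_nhds.1 (hinc.comp hψ.tendsto_atTop) s).add
      ((tendsto_pi_nhds.1 hlim s).add_const g)
    refine tendsto_nhds_unique (h2.congr fun k => ?_) h1 |>.symm ▸ ?_
    · simp only [Function.comp_apply, Pi.sub_apply, hx1]
      ring
    · simp [add_comm]
  refine ⟨g, h, hfix, ?_⟩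
  -- As `h` is fixed by `T - g`, the distance of `x k` to `h` never increases, so the subsequence
  -- carries the whole sequence along.
  have hmono : ∀ k (c : ℝ), (∀ s, |x k s - h s| ≤ c) → ∀ j ≥ k, ∀ s, |x j s - h s| ≤ c := by
    intro k c hk j hj
    induction j, hj using Nat.le_induction with
    | base => exact hk
    | succ j _ ih =>
      intro s
      have := abs_bellman_sub_le (l := l) hP0 hP1 ih s
      rwa [← hfix, ← sub_sub, ← hx1] at this
  refine tendsto_pi_nhds.2 fun s => Metric.tendsto_atTop.2 fun ε hε => ?_
  obtain ⟨K, hK⟩ := Metric.tendsto_atTop.1 hlim (ε / 2) (by linarith)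
  refine ⟨ψ K, fun j hj => ?_⟩
  have h1 : ∀ s, |x (ψ K) s - h s| ≤ ε / 2 := fun s => by
    have := (dist_le_pi_dist _ _ s).trans (hK K le_rfl).le
    rwa [Real.dist_eq] at this
  rw [Real.dist_eq]
  exact (hmono _ _ h1 j hj s).trans_lt (by linarith)

/-- Normalizing only shifts by constants, so `v^(k+1) = T^(k+1) 0 - T^k 0 (sref)`; the lag of one
index leaves the term `g` in the limit. -/
theorem tendsto_rvi (hP1 : ∀ s a, ∑ s', P s a s' = 1) {g : ℝ} {h : S → ℝ}
    (hlim : Tendsto (fun (k : ℕ) s => (bellman P l)^[k] 0 s - k * g) atTop (𝓝 h)) (sref : S) :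
    Tendsto (rvi P l sref) atTop (𝓝 fun s => h s - h sref + g) := by
  have hrel : ∀ k s, rvi P l sref k s - rvi P l sref k sref =
      (bellman P l)^[k] 0 s - (bellman P l)^[k] 0 sref := by
    intro k
    induction k with
    | zero => intro s; simp [rvi]
    | succ k ih =>
      intro s
      simp only [rvi, ih, sub_eq_add_neg _ ((bellman P l)^[k] 0 sref), bellman_add_const hP1,
        Function.iterate_succ_apply']
      ring
  rw [← tendsto_add_atTop_iff_nat 1]
  refine tendsto_pi_nhds.2 fun s => ?_
  have h1 := ((tendsto_add_atTop_iff_nat 1).2 (tendsto_pi_nhds.1 hlim s)).sub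
    (tendsto_pi_nhds.1 hlim sref) |>.add_const g
  refine h1.congr fun k => ?_
  simp only [rvi, hrel, sub_eq_add_neg _ ((bellman P l)^[k] 0 sref), bellman_add_const hP1,
    Function.iterate_succ_apply']
  push_cast
  ring

end Communicating

/-! ### The verification theorem for the average-cost criterion -/

theorem histProb_nonneg {S A : Type} [DecidableEq S] [Fintype A] {P : S → A → S → ℝ}
    (hP0 : ∀ s a s', 0 ≤ P s a s') (π : Policy S A) (s : S) :
    ∀ (t : ℕ) (h : Hist S A t), 0 ≤ histProb P π s t h
  | 0, h => by unfold histProb; split_ifs <;> norm_num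
  | t + 1, (h, a, s') =>
    mul_nonneg (mul_nonneg (histProb_nonneg hP0 π s t h) (π.prob_nonneg t h a)) (hP0 _ _ _)

theorem sum_hist_succ {S A : Type} [Fintype S] [Fintype A] (t : ℕ) (f : Hist S A (t + 1) → ℝ) :
    ∑ x, f x = ∑ h : Hist S A t, ∑ a : A, ∑ s' : S, f (h, a, s') := by
  have h : ∑ x, f x = ∑ x : Hist S A t × A × S, f x := rfl
  refine h.trans ((Fintype.sum_prod_type _).trans ?_)
  exact Finset.sum_congr rfl fun x _ => Fintype.sum_prod_type _

/-- The stationary deterministic policy that uses the action `f s` in the state `s`. -/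
noncomputable def Policy.stationary {S A : Type} [Fintype A] (f : S → A) : Policy S A := by
  classical exact
    { prob := fun t h a => if a = f (Hist.last t h) then 1 else 0
      prob_nonneg := fun t h a => by split_ifs <;> norm_num
      prob_sum := fun t h => by simp }

theorem sum_stationary_mul {S A : Type} [Fintype A] (f : S → A) (t : ℕ) (h : Hist S A t) (w : A → ℝ) :
    ∑ a, (Policy.stationary f).prob t h a * w a = w (f (Hist.last t h)) := by
  rw [Finset.sum_eq_single (f (Hist.last t h))] <;> simp +contextual [Policy.stationary]

section Verification

variable {S A : Type} [Fintype S] [DecidableEq S] [Fintype A] {P l : S → A → S → ℝ}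

/-- The expectation of a function of the last transition, by conditioning on the earlier history. -/
theorem sum_histProb_succ (π : Policy S A) (s : S) (t : ℕ) (f : S → A → S → ℝ) :
    ∑ x : Hist S A (t + 1), histProb P π s (t + 1) x * f (Hist.last t x.1) x.2.1 x.2.2 =
      ∑ h : Hist S A t, histProb P π s t h * ∑ a, π.prob t h a *
        ∑ s', P (Hist.last t h) a s' * f (Hist.last t h) a s' := by
  rw [sum_hist_succ]
  simp only [histProb, Finset.mul_sum, mul_assoc]

theorem sum_histProb (hP1 : ∀ s a, ∑ s', P s a s' = 1) (π : Policy S A) (s : S) (t : ℕ) :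
    ∑ h : Hist S A t, histProb P π s t h = 1 := by
  induction t with
  | zero =>
    have : ∑ h : Hist S A 0, histProb P π s 0 h = ∑ x : S, if x = s then (1 : ℝ) else 0 := rfl
    rw [this]
    simp
  | succ t ih =>
    have := sum_histProb_succ (P := P) π s t fun _ _ _ => 1
    simpa [hP1, π.prob_sum, ih] using this

/-- The expectation of `v (S_t)`. -/
noncomputable def expectedValue (P : S → A → S → ℝ) (π : Policy S A) (s : S) (v : S → ℝ)
    (t : ℕ) : ℝ :=
  ∑ h : Hist S A t, histProb P π s t h * v (Hist.last t h)

theorem expectedValue_zero (π : Policy S A) (s : S) (v : S → ℝ) :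
    expectedValue P π s v 0 = v s := by
  have : expectedValue P π s v 0 = ∑ x : S, (if x = s then (1 : ℝ) else 0) * v x := rfl
  rw [this]
  simp

theorem abs_sum_histProb_mul_le (hP0 : ∀ s a s', 0 ≤ P s a s') (hP1 : ∀ s a, ∑ s', P s a s' = 1)
    (π : Policy S A) (s : S) (t : ℕ) {f : Hist S A t → ℝ} {C : ℝ} (hf : ∀ h, |f h| ≤ C) :
    |∑ h : Hist S A t, histProb P π s t h * f h| ≤ C := by
  refine (Finset.abs_sum_le_sum_abs _ _).trans ?_
  simp only [abs_mul, abs_of_nonneg (histProb_nonneg hP0 π s t _)]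
  exact sum_mul_le_of_le (histProb_nonneg hP0 π s t) (sum_histProb hP1 π s t) hf

theorem expectedCost_add_expectedValue (π : Policy S A) (s : S) (v : S → ℝ) (t : ℕ) :
    expectedCost P l π s t + expectedValue P π s v (t + 1) =
      ∑ h : Hist S A t, histProb P π s t h * ∑ a, π.prob t h a *
        ∑ s', P (Hist.last t h) a s' * (l (Hist.last t h) a s' + v s') := by
  rw [← sum_histProb_succ π s t fun x a s' => l x a s' + v s']
  simp only [mul_add, Finset.sum_add_distrib]
  rfl

theorem sum_histProb_mul_add (hP1 : ∀ s a, ∑ s', P s a s' = 1) (π : Policy S A) (s : S)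
    (v : S → ℝ) (g : ℝ) (t : ℕ) :
    ∑ h : Hist S A t, histProb P π s t h * (g + v (Hist.last t h)) =
      g + expectedValue P π s v t := by
  simp only [mul_add, Finset.sum_add_distrib, expectedValue]
  rw [← Finset.sum_mul, sum_histProb hP1, one_mul]

theorem tendsto_mul_add_div (g : ℝ) {e : ℕ → ℝ} {B : ℝ} (he : ∀ T, |e T| ≤ B) :
    Tendsto (fun T : ℕ => (1 / (T : ℝ)) * (T * g + e T)) atTop (𝓝 g) := by
  have h0 : Tendsto (fun T : ℕ => e T * (1 / (T : ℝ))) atTop (𝓝 0) :=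
    isBoundedUnder_le_mul_tendsto_zero (isBoundedUnder_of ⟨B, fun T => by simpa using he T⟩)
      tendsto_one_div_atTop_nhds_zero_nat
  have h1 := h0.const_add g
  rw [add_zero] at h1
  refine h1.congr' ?_
  filter_upwards [eventually_gt_atTop 0] with T hT
  have : (T : ℝ) ≠ 0 := by positivity
  field_simp

variable [Nonempty A]

/-- A randomized action averages at least the minimum in Bellman's equation; the resulting one-slot
inequalities telescope. -/
theorem mul_add_le_sum_expectedCost (hP0 : ∀ s a s', 0 ≤ P s a s')
    (hP1 : ∀ s a, ∑ s', P s a s' = 1) {g : ℝ} {v : S → ℝ} (hv : SolvesBellman P l g v)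
    (π : Policy S A) (s : S) (T : ℕ) :
    T * g + (v s - expectedValue P π s v T) ≤ ∑ t ∈ Finset.range T, expectedCost P l π s t := by
  induction T with
  | zero => simp [expectedValue_zero]
  | succ T ih =>
    have h1 : g + expectedValue P π s v T ≤
        expectedCost P l π s T + expectedValue P π s v (T + 1) := by
      rw [expectedCost_add_expectedValue, ← sum_histProb_mul_add hP1]
      refine Finset.sum_le_sum fun h _ =>
        mul_le_mul_of_nonneg_left ?_ (histProb_nonneg hP0 π s T h)
      rw [hv, ← one_mul (bellman P l v _), ← π.prob_sum T h, Finset.sum_mul]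
      exact Finset.sum_le_sum fun a _ =>
        mul_le_mul_of_nonneg_left (bellman_le P l v _ a) (π.prob_nonneg T h a)
    rw [Finset.sum_range_succ]
    push_cast
    linarith

/-- The stationary policy of minimizing actions turns each one-slot inequality into an equality. -/
theorem exists_sum_expectedCost_eq (hP1 : ∀ s a, ∑ s', P s a s' = 1) {g : ℝ} {v : S → ℝ}
    (hv : SolvesBellman P l g v) : ∃ π : Policy S A, ∀ s (T : ℕ),
      ∑ t ∈ Finset.range T, expectedCost P l π s t = T * g + (v s - expectedValue P π s v T) := by
  choose f hf using exists_eq_bellman P l v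
  refine ⟨Policy.stationary f, fun s T => ?_⟩
  induction T with
  | zero => simp [expectedValue_zero]
  | succ T ih =>
    have h1 := expectedCost_add_expectedValue (P := P) (l := l) (Policy.stationary f) s v T
    simp only [sum_stationary_mul, ← hf, ← hv _, sum_histProb_mul_add hP1] at h1
    rw [Finset.sum_range_succ, ih]
    push_cast
    linarith

theorem SolvesBellman.isOptimalAverageCost (hP0 : ∀ s a s', 0 ≤ P s a s')
    (hP1 : ∀ s a, ∑ s', P s a s' = 1) {g : ℝ} {v : S → ℝ} (hv : SolvesBellman P l g v) :
    IsOptimalAverageCost P l g := by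
  intro s
  obtain ⟨C, hC⟩ := exists_forall_abs_le l
  obtain ⟨B, hB⟩ : ∃ B, ∀ s, |v s| ≤ B := by
    obtain ⟨B, hB⟩ := (Set.finite_range fun s => |v s|).bddAbove
    exact ⟨B, fun s => hB ⟨s, rfl⟩⟩
  have hlim : ∀ π : Policy S A, Tendsto
      (fun T : ℕ => (1 / (T : ℝ)) * (T * g + (v s - expectedValue P π s v T))) atTop (𝓝 g) :=
    fun π => tendsto_mul_add_div g (B := B + B) fun T =>
      (abs_sub _ _).trans
        (add_le_add (hB s) (abs_sum_histProb_mul_le hP0 hP1 π s T fun h => hB _))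
  have hcost : ∀ (π : Policy S A) t, expectedCost P l π s t ≤ C := fun π t =>
    (abs_le.1 (abs_sum_histProb_mul_le hP0 hP1 π s (t + 1) fun h => hC _ _ _)).2
  refine IsLeast.isGLB ⟨?_, ?_⟩
  · obtain ⟨π, hπ⟩ := exists_sum_expectedCost_eq hP1 hv
    refine ⟨π, Tendsto.limsup_eq ?_⟩
    simp only [hπ]
    exact hlim π
  · rintro _ ⟨π, rfl⟩
    -- A real `limsup` is meaningful only for bounded averages, so comparing with it needs this
    -- bound.
    have hbdd : IsBoundedUnder (· ≤ ·) atTop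
        fun T : ℕ => (1 / (T : ℝ)) * ∑ t ∈ Finset.range T, expectedCost P l π s t := by
      refine isBoundedUnder_of ⟨|C|, fun T => ?_⟩
      have h1 : ∑ t ∈ Finset.range T, expectedCost P l π s t ≤ T * |C| := by
        refine (Finset.sum_le_sum fun t _ => (hcost π t).trans (le_abs_self C)).trans ?_
        simp
      rw [one_div, inv_mul_eq_div]
      exact div_le_of_le_mul₀ (by positivity) (abs_nonneg C) (by linarith)
    rw [← (hlim π).limsup_eq]
    refine limsup_le_limsup (Eventually.of_forall fun T => ?_) (hlim π).isCoboundedUnder_le hbdd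
    exact mul_le_mul_of_nonneg_left (mul_add_le_sum_expectedCost hP0 hP1 hv π s T) (by positivity)

end Verification

theorem SolvesBellman.add_const {S A : Type} [Fintype S] [Fintype A] [Nonempty A]
    {P l : S → A → S → ℝ} (hP1 : ∀ s a, ∑ s', P s a s' = 1) {g : ℝ} {v : S → ℝ}
    (hv : SolvesBellman P l g v) (c : ℝ) : SolvesBellman P l g fun s => v s + c := fun s => by
  simp only [bellman_add_const hP1, ← hv s, add_assoc]

/-! ### The remote estimation system -/

namespace Model

variable {M : ℕ} (E : Model M)

theorem subTrans_nonneg (m : Fin M) (a : Option (Fin M)) (x y : Fin (E.N m) × Fin (E.N m)) :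
    0 ≤ E.subTrans m a x y := by
  have h1 := E.Q_nonneg m x.1 y.1
  have h2 := E.ps_nonneg
  have h3 := sub_nonneg.2 E.ps_le_one
  unfold subTrans
  split_ifs <;> positivity

theorem sum_subTrans (m : Fin M) (a : Option (Fin M)) (x : Fin (E.N m) × Fin (E.N m)) :
    ∑ y, E.subTrans m a x y = 1 := by
  rw [Fintype.sum_prod_type]
  unfold subTrans
  by_cases h : a = some m ∧ x.1 ≠ x.2
  · have key : ∀ k j, (if j = x.1 then E.Q m x.1 k * E.ps
        else if j = x.2 then E.Q m x.1 k * (1 - E.ps) else 0) =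
        (if j = x.1 then E.Q m x.1 k * E.ps else 0) +
          if j = x.2 then E.Q m x.1 k * (1 - E.ps) else 0 := fun k j => by
      by_cases h1 : j = x.1
      · subst h1
        simp [h.2]
      · simp [h1]
    simp only [if_pos h, key, Finset.sum_add_distrib, Finset.sum_ite_eq', Finset.mem_univ, if_true,
      ← Finset.sum_mul, E.Q_sum]
    ring
  · simp [if_neg h, E.Q_sum]

theorem trans_nonneg (s : E.State) (a : E.Action) (s' : E.State) : 0 ≤ E.trans s a s' :=
  Finset.prod_nonneg fun m _ => E.subTrans_nonneg m a (s m) (s' m)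

theorem sum_trans (s : E.State) (a : E.Action) : ∑ s', E.trans s a s' = 1 := by
  unfold trans
  rw [← Fintype.prod_sum fun m y => E.subTrans m a (s m) y]
  simp [sum_subTrans]

variable {E}

theorem subTrans_pos_of_ne {m : Fin M} {a : Option (Fin M)} {x : Fin (E.N m) × Fin (E.N m)}
    (h : ¬ (a = some m ∧ x.1 ≠ x.2)) {k : Fin (E.N m)} (hk : 0 < E.Q m x.1 k) :
    0 < E.subTrans m a x (k, x.2) := by
  simpa [subTrans, if_neg h] using hk

theorem subTrans_pos_of_success (hps : 0 < E.ps) {m : Fin M} {x : Fin (E.N m) × Fin (E.N m)}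
    (h : x.1 ≠ x.2) (hdiag : 0 < E.Q m x.1 x.1) : 0 < E.subTrans m (some m) x (x.1, x.1) := by
  simpa [subTrans, h] using mul_pos hdiag hps

/-- Every source keeps its state, and a mismatched transmitting source is received. -/
theorem trans_update_pos (hdiag : ∀ m i, 0 < E.Q m i i) (hps : 0 < E.ps) (s : E.State)
    {m : Fin M} (h : (s m).1 ≠ (s m).2) :
    0 < E.trans s (some m) (Function.update s m ((s m).1, (s m).1)) := by
  refine Finset.prod_pos fun n _ => ?_
  by_cases hn : n = m
  · subst hn
    rw [Function.update_self]
    exact subTrans_pos_of_success hps h (hdiag _ _)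
  · rw [Function.update_of_ne hn]
    exact subTrans_pos_of_ne (fun h' => hn (Option.some_injective _ h'.1).symm) (hdiag _ _)

theorem trans_none_update_pos (hdiag : ∀ m i, 0 < E.Q m i i) (s : E.State) {m : Fin M}
    {k : Fin (E.N m)} (hk : 0 < E.Q m (s m).1 k) :
    0 < E.trans s none (Function.update s m (k, (s m).2)) := by
  refine Finset.prod_pos fun n _ => ?_
  by_cases hn : n = m
  · subst hn
    rw [Function.update_self]
    exact subTrans_pos_of_ne (by simp) hk
  · rw [Function.update_of_ne hn]
    exact subTrans_pos_of_ne (by simp) (hdiag _ _)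

theorem trans_self_pos (hdiag : ∀ m i, 0 < E.Q m i i) {s : E.State} {a : E.Action}
    (h : ∀ m, a = some m → (s m).1 = (s m).2) : 0 < E.trans s a s :=
  Finset.prod_pos fun m _ => subTrans_pos_of_ne (fun h' => h'.2 (h m h'.1)) (hdiag _ _)

/-- The sources whose state differs from its estimate. -/
def mismatched (s : E.State) : Finset (Fin M) :=
  Finset.univ.filter fun m => (s m).1 ≠ (s m).2

/-- If no mismatched source transmits, the positive diagonals give a self-loop. Otherwise a
successful transmission with all sources at rest repairs one mismatch and creates none. -/
theorem exists_trans_pos (hdiag : ∀ m i, 0 < E.Q m i i) (hps : 0 < E.ps) (s : E.State)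
    (a : E.Action) :
    ∃ s', (s' = s ∨ (mismatched s').card < (mismatched s).card) ∧ 0 < E.trans s a s' := by
  by_cases h : ∀ m, a = some m → (s m).1 = (s m).2
  · exact ⟨s, Or.inl rfl, trans_self_pos hdiag h⟩
  · push Not at h
    obtain ⟨m, rfl, hm⟩ := h
    refine ⟨_, Or.inr (Finset.card_lt_card ?_), trans_update_pos hdiag hps s hm⟩
    refine Finset.ssubset_iff_of_subset (fun n hn => ?_) |>.2
      ⟨m, by simpa [mismatched] using hm, ?_⟩
    · by_cases hnm : n = m
      · subst hnm
        simp [mismatched] at hn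
      · simpa [mismatched, Function.update_of_ne hnm] using hn
    · simp [mismatched]

/-- `s'` can be reached from `s` in one slot under some action. -/
def CanStep (s s' : E.State) : Prop := ∃ a, 0 < E.trans s a s'

/-- Walk along a path of positive entries of `Q m` while idling; the other sources rest by their
positive diagonals. -/
theorem reach_update_fst (hirr : ∀ m, (E.Q m).IsIrreducible) (hdiag : ∀ m i, 0 < E.Q m i i)
    (s : E.State) (m : Fin M) (k : Fin (E.N m)) :
    Relation.ReflTransGen CanStep s (Function.update s m (k, (s m).2)) := by
  let : Quiver (Fin (E.N m)) := Matrix.toQuiver (E.Q m)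
  obtain ⟨p, -⟩ := (hirr m).connected (s m).1 k
  induction p with
  | nil => simpa using Relation.ReflTransGen.refl
  | cons p e ih =>
    refine ih.tail ⟨none, ?_⟩
    have := trans_none_update_pos hdiag (Function.update s m (_, (s m).2)) (m := m)
      (by simpa using e.down)
    simpa using this

/-- An estimate changes only by a successful transmission: bring the source to `y.2`, transmit, then
move it to `y.1`. -/
theorem reach_update (hirr : ∀ m, (E.Q m).IsIrreducible) (hdiag : ∀ m i, 0 < E.Q m i i)
    (hps : 0 < E.ps) (s : E.State) (m : Fin M) (y : Fin (E.N m) × Fin (E.N m)) :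
    Relation.ReflTransGen CanStep s (Function.update s m y) := by
  by_cases h : y.2 = (s m).2
  · have := reach_update_fst hirr hdiag s m y.1
    rwa [← h] at this
  · refine (reach_update_fst hirr hdiag s m y.2).trans (Relation.ReflTransGen.head
      ⟨some m, trans_update_pos hdiag hps _ (m := m) (by simpa using h)⟩ ?_)
    simpa using reach_update_fst hirr hdiag (Function.update s m (y.2, y.2)) m y.1

theorem reach (hirr : ∀ m, (E.Q m).IsIrreducible) (hdiag : ∀ m i, 0 < E.Q m i i)
    (hps : 0 < E.ps) (s t : E.State) : Relation.ReflTransGen CanStep s t := by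
  have key : ∀ I : Finset (Fin M),
      Relation.ReflTransGen CanStep s fun m => if m ∈ I then t m else s m := by
    intro I
    induction I using Finset.induction_on with
    | empty => simpa using Relation.ReflTransGen.refl
    | insert m I hm ih =>
      have := ih.trans (reach_update hirr hdiag hps _ m (t m))
      convert this using 1
      funext n
      by_cases hn : n = m
      · subst hn
        simp
      · simp [hn]
  simpa using key Finset.univ

end Model

end SemanticRE

theorem proposition2 {M : ℕ} (E : SemanticRE.Model M)
    (hirr : ∀ m, (E.Q m).IsIrreducible)
    (hdiag : ∀ m i, 0 < E.Q m i i)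
    (hps : 0 < E.ps)
    (lam : ℝ) (hlam : 0 ≤ lam) (sref : E.State) :
    ∃ v : E.State → ℝ,
      Filter.Tendsto (SemanticRE.rvi E.trans (E.lagrangianCost lam) sref) Filter.atTop (nhds v) ∧
      SemanticRE.IsOptimalAverageCost E.trans (E.lagrangianCost lam) (v sref) ∧
      SemanticRE.SolvesBellman E.trans (E.lagrangianCost lam) (v sref)
        (fun s => v s - v sref) := by
  have : Nonempty E.State := ⟨sref⟩
  obtain ⟨g, h, hsol, hlim⟩ := SemanticRE.exists_tendsto_iterate_bellman
    (l := E.lagrangianCost lam) E.trans_nonneg E.sum_trans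
    (SemanticRE.Model.reach hirr hdiag hps)
    (SemanticRE.Model.exists_trans_pos hdiag hps)
  refine ⟨fun s => h s - h sref + g, SemanticRE.tendsto_rvi E.sum_trans hlim sref, ?_⟩
  simp only [sub_self, zero_add, add_sub_cancel_right]
  refine ⟨hsol.isOptimalAverageCost E.trans_nonneg E.sum_trans, ?_⟩
  simpa only [sub_eq_add_neg] using hsol.add_const E.sum_trans (-h sref)
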